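/- An analytic field is a field $K$ that is complete with respect to a (possibly trivial) real-valued non-archimedean absolute value; an extension $K/k$ of analytic fields is one whose embedding $k\hookrightarrow K$ preserves absolute values. Let $\widehat{K^a}$ denote the completion of an algebraic closure $K^a$ of $K$ with respect to the unique extension of the absolute value. For an extension $K/k$ of analytic fields and a subset $S\subseteq K$, let $\widehat{k(S)^a}\subseteq\widehat{K^a}$ be the closure of the algebraic closure of $k(S)$ in $\widehat{K^a}$. The set $S$ is called topologically-algebraically independent over $k$ if $\widehat{k(S')^a}\subsetneq\widehat{k(S)^a}$ for every proper subset $S'\subsetneq S$, and topologically-algebraically generating if $\widehat{k(S)^a}=\widehat{K^a}$. The topological generating degree $\mathrm{Topdeg}(K/k)$ is the minimum of the cardinals of generating subsets of $K$, and the topological transcendence degree $\mathrm{topdeg}(K/k)$ is the supremum of the cardinals of independent subsets of $K$. Let $K/k$ be an extension of analytic fields. If $\mathrm{Topdeg}(K/k)\le\aleph_0$, then $\mathrm{topdeg}(K/k)=\mathrm{Topdeg}(K/k)$. Hence, if $\mathrm{topdeg}(K/k)$ is finite, then $\mathrm{Topdeg}(K/k)\ne\aleph_0$. -/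

import Mathlib

/-!
An *analytic field* is a field `K` with a (possibly trivial) real-valued non-archimedean absolute
value for which it is complete: `[NormedField K] [IsUltrametricDist K] [CompleteSpace K]`.
An extension `K / k` of analytic fields is a `[NormedAlgebra k K]`; for normed fields this means
that the embedding `k → K` preserves the absolute values.
-/

noncomputable section

open Cardinal

namespace AnalyticField

universe u v

section AlgClosure

variable (K : Type v) [NormedField K] [IsUltrametricDist K] [CompleteSpace K]

/-- The spectral norm on `Kᵃ` is multiplicative, also when `K` is trivially valued. -/
theorem spectralNorm_algClosure_mul (x y : AlgebraicClosure K) :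
    spectralNorm K (AlgebraicClosure K) (x * y) =
      spectralNorm K (AlgebraicClosure K) x * spectralNorm K (AlgebraicClosure K) y := by
  by_cases h : ∃ c : K, c ≠ 0 ∧ ‖c‖ ≠ 1
  · let _ : NontriviallyNormedField K := NontriviallyNormedField.ofNormNeOne h
    exact spectralAlgNorm_mul (K := K) (L := AlgebraicClosure K) x y
  · push Not at h
    have hle (c : K) : ‖c‖ ≤ 1 := by
      by_cases hc : c = 0
      · simp [hc]
      · exact (h c hc).le
    have hone (z : AlgebraicClosure K) : spectralNorm K (AlgebraicClosure K) z ≤ 1 := by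
      refine ciSup_le fun n => ?_
      unfold spectralValueTerms
      split_ifs with hn
      · refine Real.rpow_le_one (norm_nonneg _) (hle _) ?_
        have : (n : ℝ) < (minpoly K z).natDegree := by exact_mod_cast hn
        exact one_div_nonneg.mpr (by linarith)
      · exact zero_le_one
    have heq (z : AlgebraicClosure K) (hz : z ≠ 0) :
        spectralNorm K (AlgebraicClosure K) z = 1 := by
      refine le_antisymm (hone z) ?_
      have h1 := spectralNorm_mul (K := K) (Algebra.IsAlgebraic.isAlgebraic z)
        (Algebra.IsAlgebraic.isAlgebraic z⁻¹)
      rw [mul_inv_cancel₀ hz, spectralNorm_one] at h1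
      have h2 := mul_le_mul_of_nonneg_left (hone z⁻¹) (spectralNorm_nonneg (K := K) z)
      linarith
    by_cases hx : x = 0
    · simp [hx, spectralNorm_zero]
    by_cases hy : y = 0
    · simp [hy, spectralNorm_zero]
    rw [heq x hx, heq y hy, heq _ (mul_ne_zero hx hy), one_mul]

/-- The algebraic closure `Kᵃ` of an analytic field `K`, with the unique extension of the absolute
value of `K`. -/
instance algClosureNormedField : NormedField (AlgebraicClosure K) :=
  { (inferInstance : Field (AlgebraicClosure K)) with
    norm := fun x => spectralNorm K (AlgebraicClosure K) x
    dist := fun x y => spectralNorm K (AlgebraicClosure K) (x - y)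
    dist_self := fun x => by simp [sub_self, spectralNorm_zero]
    dist_comm := fun x y => by
      rw [← neg_sub, spectralNorm_neg (Algebra.IsAlgebraic.isAlgebraic _)]
    dist_triangle := fun x y z =>
      sub_add_sub_cancel x y z ▸
        isNonarchimedean_spectralNorm.add_le spectralNorm_nonneg
    eq_of_dist_eq_zero := fun {x y} hxy => by
      rw [← sub_eq_zero]
      exact eq_zero_of_map_spectralNorm_eq_zero hxy (Algebra.IsAlgebraic.isAlgebraic _)
    dist_eq := fun x y => by
      rw [← spectralNorm_neg (Algebra.IsAlgebraic.isAlgebraic (x - y)), sub_eq_add_neg, neg_add,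
        neg_neg]
    norm_mul := spectralNorm_algClosure_mul K }

instance algClosureNormedAlgebra : NormedAlgebra K (AlgebraicClosure K) :=
  { (inferInstance : Algebra K (AlgebraicClosure K)) with
    norm_smul_le := fun c x =>
      (spectralNorm_smul c (Algebra.IsAlgebraic.isAlgebraic x)).le }

/-- The completed algebraic closure of an analytic field `K`. -/
abbrev CompletedAlgClosure : Type v := UniformSpace.Completion (AlgebraicClosure K)

end AlgClosure

section Degrees

variable (k : Type u) {K : Type v} [Field k] [NormedField K] [IsUltrametricDist K]
  [CompleteSpace K] [Algebra k K]

/-- For `S ⊆ K`, the completion of `k(S)ᵃ`, realised as the closure, in the completed algebraic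
closure of `K`, of the set of all elements that are algebraic over `k(S)`. -/
def taClosure (S : Set K) : Set (CompletedAlgClosure K) :=
  closure {x : CompletedAlgClosure K | IsAlgebraic (IntermediateField.adjoin k S) x}

/-- `S ⊆ K` is topologically-algebraically independent over `k`. -/
def TAIndependent (S : Set K) : Prop :=
  ∀ S' : Set K, S' ⊂ S → taClosure k S' ⊂ taClosure k S

/-- `S ⊆ K` topologically-algebraically generates `K` over `k`. -/
def TAGenerating (S : Set K) : Prop :=
  taClosure k S = Set.univ

variable (K)

/-- The topological generating degree of `K / k`: the minimum of the cardinals of t.a. generating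
subsets of `K`. -/
def topGeneratingDegree : Cardinal.{v} :=
  sInf {c | ∃ S : Set K, TAGenerating k S ∧ #S = c}

/-- The topological transcendence degree of `K / k`: the supremum of the cardinals of
t.a. independent subsets of `K`. -/
def topTranscendenceDegree : Cardinal.{v} :=
  sSup {c | ∃ S : Set K, TAIndependent k S ∧ #S = c}

end Degrees

section Facts

variable (k : Type u) (K : Type v) [Field k] [NormedField K] [IsUltrametricDist K]
  [CompleteSpace K] [Algebra k K]

/-- `K` generates itself, so the minimum in the generating degree is over a nonempty set. -/
theorem taGenerating_univ : TAGenerating k (Set.univ : Set K) := by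
  refine Set.eq_univ_of_univ_subset ?_
  rw [← (UniformSpace.Completion.denseRange_coe (α := AlgebraicClosure K)).closure_range]
  refine closure_mono ?_
  rintro _ ⟨x, rfl⟩
  obtain ⟨p, hp, hx⟩ := Algebra.IsAlgebraic.isAlgebraic (R := K) x
  have hx' : IsAlgebraic K (x : CompletedAlgClosure K) :=
    let f : AlgebraicClosure K →ₐ[K] CompletedAlgClosure K :=
      { UniformSpace.Completion.coeRingHom (α := AlgebraicClosure K) with
        commutes' := fun _ => rfl }
    ⟨p, hp, by rw [show (x : CompletedAlgClosure K) = f x from rfl, Polynomial.aeval_algHom_apply,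
      hx, map_zero]⟩
  rw [Set.mem_ofPred_eq, IntermediateField.adjoin_univ]
  obtain ⟨q, hq, hqx⟩ := hx'
  refine ⟨q.map (IntermediateField.topEquiv (F := k) (E := K)).symm.toRingEquiv.toRingHom, ?_, ?_⟩
  · exact (Polynomial.map_ne_zero_iff (RingEquiv.injective _)).mpr hq
  · rw [Polynomial.aeval_def, Polynomial.eval₂_map]
    exact hqx

/-- The cardinals of t.a. independent sets are bounded, so that their supremum is genuine. -/
theorem bddAbove_taIndependent : BddAbove {c | ∃ S : Set K, TAIndependent k S ∧ #S = c} :=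
  ⟨#K, by rintro _ ⟨S, -, rfl⟩; exact mk_set_le S⟩

end Facts

end AnalyticField

end

noncomputable section

open Cardinal

namespace AnalyticField

universe u v

section Roots

open Polynomial

variable {L : Type*} [NormedField L] [IsUltrametricDist L]

theorem norm_coeff_mul_pow_le_of_splits {p : L[X]} (hp : p.Splits) {ε : ℝ} (hε : 0 ≤ ε)
    (h : ∀ ρ ∈ p.roots, ε ≤ ‖ρ‖) (n : ℕ) : ‖p.coeff n‖ * ε ^ n ≤ ‖p.coeff 0‖ := by
  have key (m : Multiset L) (hm : ∀ ρ ∈ m, ε ≤ ‖ρ‖) (n : ℕ) :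
      ‖((m.map fun a => X - C a).prod).coeff n‖ * ε ^ n ≤
        ‖((m.map fun a => X - C a).prod).coeff 0‖ := by
    induction m using Multiset.induction generalizing n with
    | empty => cases n <;> simp [coeff_one]
    | cons a m ih =>
      have ih := ih fun ρ hρ => hm ρ (Multiset.mem_cons_of_mem hρ)
      have ha := hm a (Multiset.mem_cons_self a m)
      rw [Multiset.map_cons, Multiset.prod_cons]
      set q := (m.map fun a => X - C a).prod
      have h0 : ‖((X - C a) * q).coeff 0‖ = ‖a‖ * ‖q.coeff 0‖ := by simp [mul_coeff_zero]
      rw [h0]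
      cases n with
      | zero => simp [mul_coeff_zero]
      | succ n =>
        rw [sub_mul, coeff_sub, coeff_X_mul, coeff_C_mul]
        have h1 := IsUltrametricDist.norm_add_le_max (q.coeff n) (-(a * q.coeff (n + 1)))
        rw [← sub_eq_add_neg, norm_neg] at h1
        refine (mul_le_mul_of_nonneg_right h1 (by positivity)).trans ?_
        rw [max_mul_of_nonneg _ _ (by positivity)]
        refine max_le ?_ ?_
        · calc ‖q.coeff n‖ * ε ^ (n + 1) = ε * (‖q.coeff n‖ * ε ^ n) := by ring
            _ ≤ ‖a‖ * ‖q.coeff 0‖ := mul_le_mul ha (ih n) (by positivity) (norm_nonneg _)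
        · rw [norm_mul, mul_assoc]
          exact mul_le_mul_of_nonneg_left (ih (n + 1)) (norm_nonneg _)
  have := mul_le_mul_of_nonneg_left (key p.roots h n) (norm_nonneg p.leadingCoeff)
  rw [hp.eq_prod_roots, coeff_C_mul, coeff_C_mul, norm_mul, norm_mul, mul_assoc]
  exact this

theorem exists_root_near [IsAlgClosed L] {p : L[X]} {z : L} {ε : ℝ} (hε : 0 ≤ ε) {n : ℕ}
    (h : ‖p.eval z‖ < ‖(taylor z p).coeff n‖ * ε ^ n) :
    ∃ ρ, p ≠ 0 ∧ p.IsRoot ρ ∧ ‖z - ρ‖ < ε := by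
  by_contra! H
  refine absurd h (not_lt.mpr ?_)
  rw [← taylor_coeff_zero]
  refine norm_coeff_mul_pow_le_of_splits (IsAlgClosed.splits _) hε (fun ρ hρ => ?_) n
  rw [mem_roots', IsRoot.def, taylor_eval] at hρ
  simpa using H (ρ + z) (fun h0 => hρ.1 (by rw [h0, map_zero])) hρ.2

end Roots

section Span

open Polynomial

variable (k : Type*) {L : Type*} [Field k] [Field L] [Algebra k L]

/-- The relative algebraic closure of `k(A)` in `L`. -/
def algSpan (A : Set L) : Subfield L :=
  (algebraicClosure (IntermediateField.adjoin k A) L).toSubfield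

variable {k}

theorem mem_algSpan {A : Set L} {x : L} :
    x ∈ algSpan k A ↔ IsAlgebraic (IntermediateField.adjoin k A) x :=
  mem_algebraicClosure_iff

theorem mem_algSpan_iff {A : Set L} {x : L} :
    x ∈ algSpan k A ↔ IsAlgebraic (Algebra.adjoin k A) x :=
  mem_algSpan.trans IntermediateField.isAlgebraic_adjoin_iff

theorem subset_algSpan (A : Set L) : A ⊆ algSpan k A := fun x hx =>
  mem_algSpan.mpr (isAlgebraic_algebraMap
    (⟨x, IntermediateField.subset_adjoin k A hx⟩ : IntermediateField.adjoin k A))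

theorem mem_algSpan_of_isAlgebraic {A : Set L} {x : L} (hx : IsAlgebraic (algSpan k A) x) :
    x ∈ algSpan k A := by
  have : IsAlgebraic (algebraicClosure (IntermediateField.adjoin k A) L) x := hx
  exact mem_algSpan.mpr (this.restrictScalars _)

theorem algSpan_le_of_subset {A : Set L} {E : Subfield L} (hk : ∀ c : k, algebraMap k L c ∈ E)
    (hE : ∀ x : L, IsAlgebraic E x → x ∈ E) (hA : A ⊆ E) : algSpan k A ≤ E := by
  intro x hx
  have h1 := mem_algSpan.mp hx
  have h2 : IntermediateField.adjoin k A ≤ E.toIntermediateField hk :=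
    IntermediateField.adjoin_le_iff.mpr hA
  exact hE x (h1.tower_top_of_subalgebra_le h2)

theorem algebraMap_mem_algSpan (A : Set L) (c : k) : algebraMap k L c ∈ algSpan k A :=
  mem_algSpan.mpr (isAlgebraic_algebraMap
    (algebraMap k (IntermediateField.adjoin k A) c))

theorem algSpan_mono {A B : Set L} (h : A ⊆ B) : algSpan k A ≤ algSpan k B :=
  algSpan_le_of_subset (algebraMap_mem_algSpan B) (fun _ => mem_algSpan_of_isAlgebraic)
    (h.trans (subset_algSpan B))

/-- The cardinality of an algebraically independent family is bounded by that of any set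
over which it is algebraic. -/
theorem cardinalMk_le_of_mem_algSpan {k : Type*} {L : Type v} [Field k] [Field L] [Algebra k L]
    {ι : Type v} {A : Set L} {a : ι → L} (ha : AlgebraicIndependent k a)
    (h : ∀ i, a i ∈ algSpan k A) : #ι ≤ #A := by
  have hinj := ha.injective
  have hI : (AlgebraicIndependent.matroid k L).Indep (Set.range a) :=
    AlgebraicIndependent.matroid_indep_iff.mpr ha.coe_range
  obtain ⟨J, hJ⟩ := (AlgebraicIndependent.matroid k L).exists_isBasis A
  have hsub : Set.range a ⊆ (AlgebraicIndependent.matroid k L).closure A := by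
    rw [AlgebraicIndependent.matroid_closure_eq]
    rintro _ ⟨i, rfl⟩
    exact mem_algSpan_iff.mp (h i)
  have h1 := hI.cardinalMk_le_isBasis' hJ.isBasis_closure_right.isBasis' hsub
  rw [Cardinal.mk_range_eq a hinj] at h1
  exact h1.trans (Cardinal.mk_le_mk_of_subset hJ.subset)

end Span

section Near

variable {k : Type*} {L : Type*} [Field k] [NormedField L] [Algebra k L]

theorem exists_mem_algSpan_near {A : Set L} {x : L} (hx : x ∈ (algSpan k A).topologicalClosure)
    {ε : ℝ} (hε : 0 < ε) : ∃ f ∈ algSpan k A, ‖x - f‖ < ε := by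
  obtain ⟨f, hf, h⟩ := Metric.mem_closure_iff.mp hx ε hε
  exact ⟨f, hf, by rwa [← dist_eq_norm]⟩

theorem mem_topologicalClosure_of_near {A : Set L} {x : L}
    (h : ∀ ε > 0, ∃ f ∈ algSpan k A, ‖x - f‖ < ε) : x ∈ (algSpan k A).topologicalClosure := by
  change x ∈ closure (algSpan k A : Set L)
  rw [Metric.mem_closure_iff]
  intro ε hε
  obtain ⟨f, hf, hd⟩ := h ε hε
  exact ⟨f, hf, by rwa [dist_eq_norm]⟩

end Near

section Closure

open Polynomial Topology

variable {k : Type*} {L : Type*} [NormedField L] [IsUltrametricDist L] [IsAlgClosed L]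

/-- The topological closure of an algebraically closed subfield is algebraically closed. -/
theorem mem_topologicalClosure_of_isAlgebraic {E : Subfield L}
    (hE : ∀ x : L, IsAlgebraic E x → x ∈ E) {y : L}
    (hy : IsAlgebraic E.topologicalClosure y) : y ∈ E.topologicalClosure := by
  change y ∈ closure (E : Set L)
  rw [Metric.mem_closure_iff]
  intro ε hε
  set f := minpoly E.topologicalClosure y
  have hf : f.Monic := minpoly.monic hy.isIntegral
  set d := f.natDegree
  have hfy : y ^ d + ∑ i : Fin d, ((f.coeff i : E.topologicalClosure) : L) * y ^ (i : ℕ) = 0 := by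
    have h := minpoly.aeval E.topologicalClosure y
    rw [aeval_eq_sum_range, Finset.sum_range_succ, add_comm, ← Fin.sum_univ_eq_sum_range
      (fun i => f.coeff i • y ^ i)] at h
    rw [← h]
    congr 1
    change _ = f.leadingCoeff • y ^ d
    rw [hf.leadingCoeff, one_smul]
  have hmem : (fun i : Fin d => ((f.coeff i : E.topologicalClosure) : L)) ∈
      closure (Set.univ.pi fun _ => (E : Set L)) := by
    rw [closure_pi_set]
    exact fun i _ => (f.coeff i).2
  have hopen : IsOpen {c : Fin d → L | ‖y ^ d + ∑ i : Fin d, c i * y ^ (i : ℕ)‖ < ε ^ d} :=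
    isOpen_lt (by fun_prop) continuous_const
  obtain ⟨c, hc, hcE⟩ := mem_closure_iff.mp hmem _ hopen (by
    rw [Set.mem_ofPred_eq, hfy, norm_zero]; positivity)
  let c' : Fin d → E := fun i => ⟨c i, hcE i (Set.mem_univ i)⟩
  let g : E[X] := X ^ d + ∑ i : Fin d, C (c' i) * X ^ (i : ℕ)
  have hgdeg : (∑ i : Fin d, C (c' i) * X ^ (i : ℕ)).degree < (d : WithBot ℕ) :=
    degree_sum_fin_lt c'
  have hg : g.Monic := monic_X_pow_add hgdeg
  have hgd : g.natDegree = d := by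
    rw [natDegree_eq_of_degree_eq (degree_add_eq_left_of_degree_lt (by rwa [degree_X_pow])),
      natDegree_X_pow]
  have hgL : (g.map E.subtype).Monic := hg.map _
  have hev : (g.map E.subtype).eval y = y ^ d + ∑ i : Fin d, c i * y ^ (i : ℕ) := by
    simp [g, eval_finsetSum, Polynomial.map_sum, c']
  obtain ⟨ρ, -, hρ, hd⟩ := exists_root_near (p := g.map E.subtype) (z := y) hε.le (n := d) (by
    have : (taylor y (g.map E.subtype)).coeff d = 1 := by
      rw [← hgd, ← hg.natDegree_map E.subtype, coeff_taylor_natDegree, hgL.leadingCoeff]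
    rw [this, norm_one, one_mul, hev]
    exact hc)
  refine ⟨ρ, hE ρ ⟨g, hg.ne_zero, ?_⟩, by rwa [dist_eq_norm]⟩
  rw [aeval_def, eval₂_eq_eval_map]
  exact hρ

variable [Field k] [Algebra k L]

theorem algSpan_le_topologicalClosure {A B : Set L}
    (h : A ⊆ (algSpan k B).topologicalClosure) :
    algSpan k A ≤ (algSpan k B).topologicalClosure :=
  algSpan_le_of_subset
    (fun c => (algSpan k B).le_topologicalClosure (algebraMap_mem_algSpan B c))
    (fun _ => mem_topologicalClosure_of_isAlgebraic fun _ => mem_algSpan_of_isAlgebraic) h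

theorem topologicalClosure_algSpan_le {A B : Set L}
    (h : A ⊆ (algSpan k B).topologicalClosure) :
    (algSpan k A).topologicalClosure ≤ (algSpan k B).topologicalClosure :=
  (algSpan k A).topologicalClosure_minimal (algSpan_le_topologicalClosure h)
    (algSpan k B).isClosed_topologicalClosure

theorem topologicalClosure_algSpan_mono {A B : Set L} (h : A ⊆ B) :
    (algSpan k A).topologicalClosure ≤ (algSpan k B).topologicalClosure :=
  topologicalClosure_algSpan_le
    ((h.trans (subset_algSpan B)).trans (algSpan k B).le_topologicalClosure)

/-- Elements algebraic over `k(y)` can be followed when `y` moves a little. -/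
theorem eventually_exists_mem_algSpan_near {ι : Type*} {y : ι → L} {f : L}
    (hf : f ∈ algSpan k (Set.range y)) {ε : ℝ} (hε : 0 < ε) :
    ∀ᶠ y' in 𝓝 y, ∃ f' ∈ algSpan k (Set.range y'), ‖f - f'‖ < ε := by
  rw [mem_algSpan_iff] at hf
  obtain ⟨q, hq, hqf⟩ := hf
  let ev (z : ι → L) : MvPolynomial ι k →+* L := (MvPolynomial.aeval z).toRingHom
  obtain ⟨P, hP⟩ : ∃ P : (MvPolynomial ι k)[X],
      P.map (ev y) = q.map (algebraMap (Algebra.adjoin k (Set.range y)) L) := by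
    have hl : q.map (algebraMap (Algebra.adjoin k (Set.range y)) L) ∈ lifts (ev y) := by
      rw [lifts_iff_coeff_lifts]
      intro n
      rw [coeff_map]
      exact (Algebra.adjoin_range_eq_range_aeval k y).le (q.coeff n).2
    obtain ⟨P, hP⟩ := hl
    exact ⟨P, hP⟩
  have hP0 : P.map (ev y) ≠ 0 := by
    rw [hP]
    exact (Polynomial.map_ne_zero_iff Subtype.val_injective).mpr hq
  have hPf : (P.map (ev y)).eval f = 0 := by
    rw [hP, ← hqf, aeval_def, eval₂_eq_eval_map]
  have hcont (n : ℕ) : Continuous fun z => (taylor f (P.map (ev z))).coeff n := by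
    have h (z : ι → L) : (taylor f (P.map (ev z))).coeff n =
        ∑ i ∈ Finset.range (P.natDegree + 1),
          ev z (P.coeff i) * (taylor f (X ^ i : L[X])).coeff n := by
      conv_lhs => rw [P.as_sum_range_C_mul_X_pow]
      simp only [Polynomial.map_sum, Polynomial.map_mul, map_C, Polynomial.map_pow, map_X,
        map_sum, taylor_mul, taylor_C, finsetSum_coeff, coeff_C_mul]
    simp_rw [h]
    refine continuous_finsetSum _ fun i _ => Continuous.mul ?_ continuous_const
    change Continuous fun z => MvPolynomial.aeval z (P.coeff i)
    simp_rw [MvPolynomial.aeval_def, MvPolynomial.eval₂_eq_eval_map]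
    exact MvPolynomial.continuous_eval _
  obtain ⟨n, hn⟩ : ∃ n, (taylor f (P.map (ev y))).coeff n ≠ 0 := by
    by_contra! h
    exact hP0 ((taylor_eq_zero f _).mp (Polynomial.ext fun n => by simpa using h n))
  have hlt : ∀ᶠ z in 𝓝 y, ‖(taylor f (P.map (ev z))).coeff 0‖ <
      ‖(taylor f (P.map (ev z))).coeff n‖ * ε ^ n := by
    refine (hcont 0).norm.continuousAt.eventually_lt
      ((hcont n).norm.mul continuous_const).continuousAt ?_
    rw [taylor_coeff_zero, hPf, norm_zero]
    have := norm_pos_iff.mpr hn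
    positivity
  filter_upwards [hlt] with z hz
  rw [taylor_coeff_zero] at hz
  obtain ⟨ρ, hp, hρ, hd⟩ := exists_root_near hε.le hz
  refine ⟨ρ, ?_, hd⟩
  have hl : P.map (ev z) ∈ lifts (algebraMap (Algebra.adjoin k (Set.range z)) L) := by
    rw [lifts_iff_coeff_lifts]
    intro n
    rw [coeff_map]
    refine ⟨⟨ev z (P.coeff n), ?_⟩, rfl⟩
    rw [Algebra.adjoin_range_eq_range_aeval]
    exact ⟨_, rfl⟩
  obtain ⟨r, hr⟩ := hl
  rw [coe_mapRingHom] at hr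
  refine mem_algSpan_iff.mpr ⟨r, ?_, ?_⟩
  · rintro rfl
    exact hp (by rw [← hr, Polynomial.map_zero])
  · rw [aeval_def, eval₂_eq_eval_map, hr]
    exact hρ

end Closure

section Slice

variable {ι : Type*} [DecidableEq ι] {R S : Type*} [CommRing R] [CommRing S]

/-- The part of a polynomial in `X_j`, `j : ι`, that involves only the monomials `X ^ β * X_i ^ n`,
as a polynomial in one variable. -/
def slice (i : ι) (β : ι →₀ ℕ) : MvPolynomial ι R →ₗ[R] Polynomial R :=
  (MvPolynomial.basisMonomials ι R).constr R fun α =>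
    if α.erase i = β then Polynomial.monomial (α i) 1 else 0

theorem slice_monomial (i : ι) (β α : ι →₀ ℕ) (c : R) :
    slice i β (MvPolynomial.monomial α c) =
      if α.erase i = β then Polynomial.monomial (α i) c else 0 := by
  have h : MvPolynomial.monomial α c = c • MvPolynomial.basisMonomials ι R α := by
    rw [MvPolynomial.coe_basisMonomials, MvPolynomial.smul_monomial, smul_eq_mul, mul_one]
  rw [h, map_smul, slice, Module.Basis.constr_basis]
  split_ifs
  · rw [Polynomial.smul_monomial, smul_eq_mul, mul_one]
  · rw [smul_zero]

theorem coeff_slice {i : ι} {β : ι →₀ ℕ} (hβ : β i = 0) (P : MvPolynomial ι R) (n : ℕ) :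
    (slice i β P).coeff n = P.coeff (β + Finsupp.single i n) := by
  induction P using MvPolynomial.induction_on' with
  | monomial α c =>
    rw [slice_monomial, MvPolynomial.coeff_monomial]
    by_cases h : α = β + Finsupp.single i n
    · subst h
      simp [Finsupp.erase_add, Finsupp.erase_of_notMem_support, hβ]
    · rw [if_neg h]
      split_ifs with h'
      · rw [Polynomial.coeff_monomial, if_neg]
        rintro rfl
        exact h (by rw [← h', Finsupp.erase_add_single])
      · simp
  | add p q hp hq => rw [map_add, Polynomial.coeff_add, hp, hq, MvPolynomial.coeff_add]

theorem slice_map (f : R →+* S) {i : ι} {β : ι →₀ ℕ} (hβ : β i = 0) (P : MvPolynomial ι R) :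
    slice i β (MvPolynomial.map f P) = (slice i β P).map f := by
  ext n
  rw [Polynomial.coeff_map, coeff_slice hβ, coeff_slice hβ, MvPolynomial.coeff_map]

/-- Translation of the single variable `X_i`. -/
def shift (i : ι) (b : R) : MvPolynomial ι R →ₐ[R] MvPolynomial ι R :=
  MvPolynomial.aeval (Function.update MvPolynomial.X i (MvPolynomial.X i + MvPolynomial.C b))

theorem slice_monomial_mul_aeval_X {i : ι} {β γ : ι →₀ ℕ} (hγ : γ i = 0) (c : R)
    (g : Polynomial R) :
    slice i β (MvPolynomial.monomial γ c * Polynomial.aeval (MvPolynomial.X i) g) =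
      if γ = β then Polynomial.C c * g else 0 := by
  induction g using Polynomial.induction_on' with
  | add p q hp hq =>
    rw [map_add, mul_add, map_add, hp, hq]
    split_ifs
    · rw [mul_add]
    · rw [add_zero]
  | monomial n a =>
    rw [Polynomial.aeval_monomial, MvPolynomial.algebraMap_eq, MvPolynomial.C_mul_X_pow_eq_monomial,
      MvPolynomial.monomial_mul, slice_monomial]
    simp [Finsupp.erase_add, Finsupp.erase_of_notMem_support, hγ, Polynomial.C_mul_monomial]

theorem slice_shift (i : ι) (β : ι →₀ ℕ) (b : R) (P : MvPolynomial ι R) :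
    slice i β (shift i b P) = Polynomial.taylor b (slice i β P) := by
  induction P using MvPolynomial.induction_on' with
  | add p q hp hq => simp only [map_add, hp, hq]
  | monomial α c =>
    have h1 : MvPolynomial.monomial α c =
        MvPolynomial.monomial (α.erase i) c * MvPolynomial.X i ^ α i := by
      rw [MvPolynomial.X_pow_eq_monomial, MvPolynomial.monomial_mul, mul_one,
        Finsupp.erase_add_single]
    have h2 : shift i b (MvPolynomial.monomial (α.erase i) c) =
        MvPolynomial.monomial (α.erase i) c := by
      rw [shift, MvPolynomial.aeval_monomial, MvPolynomial.monomial_eq, MvPolynomial.algebraMap_eq]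
      congr 1
      refine Finsupp.prod_congr fun j hj => ?_
      rw [Function.update_of_ne]
      rintro rfl
      simp at hj
    have h3 : shift i b (MvPolynomial.X i ^ α i) = Polynomial.aeval (MvPolynomial.X i)
        ((Polynomial.X + Polynomial.C b) ^ α i) := by
      simp [shift]
    rw [slice_monomial]
    conv_lhs => rw [h1]
    rw [map_mul, h2, h3, slice_monomial_mul_aeval_X (by simp)]
    split_ifs
    · rw [Polynomial.taylor_monomial]
    · rw [map_zero]

end Slice

section Independence

open MvPolynomial

variable {k : Type*} {L : Type*} [Field k] [NormedField L] [IsUltrametricDist L] [IsAlgClosed L]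
  [Algebra k L] {ι : Type*}

/-- `b` keeps distance at least `ε` from algebraic dependence: no `b i` is at distance less than
`ε` from an element that is algebraic over the remaining ones. -/
def IsSeparated (k : Type*) [Field k] [Algebra k L] (ε : ℝ) (b : ι → L) : Prop :=
  ∀ i, ∀ f ∈ algSpan k (b '' {i}ᶜ), ε ≤ ‖b i - f‖

theorem norm_coeff_add_single_mul_pow_le {ε : ℝ} (hε : 0 ≤ ε) {b : ι → L}
    (hb : IsSeparated k ε b) (P : MvPolynomial ι k) {i : ι} {β : ι →₀ ℕ} (hβ : β i = 0) (n : ℕ) :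
    ‖(aeval (fun j => X j + C (b j)) P : MvPolynomial ι L).coeff (β + Finsupp.single i n)‖ * ε ^ n ≤
      ‖(aeval (fun j => X j + C (b j)) P : MvPolynomial ι L).coeff β‖ := by
  classical
  let F := IntermediateField.adjoin k (b '' {i}ᶜ)
  let b' : ι → F := fun j => if h : j = i then 0 else
    ⟨b j, IntermediateField.subset_adjoin k _ ⟨j, h, rfl⟩⟩
  have hb' : ∀ j, j ≠ i → (b' j : L) = b j := fun j hj => by simp [b', hj]
  have hbi : (b' i : L) = 0 := by simp [b']
  let R : MvPolynomial ι F := aeval (fun j => X j + C (b' j)) P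
  have hQ : (aeval (fun j => X j + C (b j)) P : MvPolynomial ι L) =
      shift i (b i) (map (algebraMap F L) R) := by
    have : (aeval (fun j => X j + C (b j)) : MvPolynomial ι k →ₐ[k] MvPolynomial ι L) =
        (((shift i (b i)).restrictScalars k).comp
          (mapAlgHom (IsScalarTower.toAlgHom k F L))).comp (aeval (fun j => X j + C (b' j))) := by
      refine algHom_ext fun j => ?_
      by_cases h : j = i
      · subst h
        simp [shift, hbi]
      · simp [shift, h, hb' j h]
    exact DFunLike.congr_fun this P
  rw [hQ]
  have h1 (m : ℕ) : (shift i (b i) (map (algebraMap F L) R)).coeff (β + Finsupp.single i m) =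
      (Polynomial.taylor (b i) ((slice i β R).map (algebraMap F L))).coeff m := by
    rw [← coeff_slice hβ, slice_shift, slice_map _ hβ]
  have h0 := h1 0
  rw [Finsupp.single_zero, add_zero, Polynomial.taylor_coeff_zero] at h0
  rw [h1, h0]
  by_contra! hlt
  obtain ⟨ρ, hne, hρ, hd⟩ := exists_root_near hε hlt
  refine absurd (hb i ρ (mem_algSpan.mpr ⟨slice i β R, ?_, ?_⟩)) (not_le.mpr hd)
  · intro h
    exact hne (by rw [h, Polynomial.map_zero])
  · rw [Polynomial.aeval_def, Polynomial.eval₂_eq_eval_map]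
    exact hρ

theorem norm_coeff_mul_pow_degree_le {ε : ℝ} (hε : 0 ≤ ε) {b : ι → L}
    (hb : IsSeparated k ε b) (P : MvPolynomial ι k) (α : ι →₀ ℕ) :
    ‖(aeval (fun j => X j + C (b j)) P : MvPolynomial ι L).coeff α‖ * ε ^ α.degree ≤
      ‖(aeval (fun j => X j + C (b j)) P : MvPolynomial ι L).coeff 0‖ := by
  classical
  induction α using Finsupp.induction with
  | zero => simp
  | single_add i n β hi hn ih =>
    have h := norm_coeff_add_single_mul_pow_le hε hb P (Finsupp.notMem_support_iff.mp hi) n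
    rw [map_add, Finsupp.degree_single, pow_add, ← mul_assoc, add_comm (Finsupp.single i n)]
    exact (mul_le_mul_of_nonneg_right h (by positivity)).trans ih

/-- A family that is close to a separated one is algebraically independent. -/
theorem IsSeparated.algebraicIndependent {ε : ℝ} {b : ι → L}
    (hb : IsSeparated k ε b) {a : ι → L} (ha : ∀ i, ‖a i - b i‖ < ε) :
    AlgebraicIndependent k a := by
  classical
  rcases isEmpty_or_nonempty ι with h | ⟨⟨i₀⟩⟩
  · exact algebraicIndependent_empty_type_iff.mpr (algebraMap k L).injective
  have hε : 0 < ε := (norm_nonneg _).trans_lt (ha i₀)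
  rw [algebraicIndependent_iff]
  intro P hP
  set Q : MvPolynomial ι L := aeval (fun j => X j + C (b j)) P with hQ
  have hev (z : ι → L) : eval z Q = aeval (fun j => z j + b j) P := by
    have : ((aeval z : MvPolynomial ι L →ₐ[L] L).restrictScalars k).comp
        (aeval (fun j => X j + C (b j))) = (aeval (fun j => z j + b j) : _ →ₐ[k] L) :=
      algHom_ext fun j => by simp
    have := DFunLike.congr_fun this P
    rw [← this]
    simp [hQ, aeval_eq_eval]
  have hcoeff := norm_coeff_mul_pow_degree_le hε.le hb P
  rw [← hQ] at hcoeff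
  by_cases h0 : Q.coeff 0 = 0
  · have hQ0 : Q = 0 := by
      ext α
      have h := hcoeff α
      rw [h0, norm_zero] at h
      have h' : ‖Q.coeff α‖ = 0 := by
        refine le_antisymm ?_ (norm_nonneg _)
        exact nonpos_of_mul_nonpos_left h (by positivity)
      simpa using h'
    have hinj : (((aeval fun j => X j - C (b j)) : MvPolynomial ι L →ₐ[L] MvPolynomial ι L)) Q =
        map (algebraMap k L) P := by
      have : ((aeval fun j => X j - C (b j) : MvPolynomial ι L →ₐ[L] _).restrictScalars k).comp
          (aeval (fun j => X j + C (b j))) = mapAlgHom (Algebra.ofId k L) :=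
        algHom_ext fun j => by simp [Algebra.ofId]
      exact DFunLike.congr_fun this P
    rw [hQ0, map_zero] at hinj
    exact map_injective _ (algebraMap k L).injective (by rw [← hinj, map_zero])
  · exfalso
    have hz : eval (fun j => a j - b j) Q = 0 := by
      rw [hev]
      simpa using hP
    rw [eval_eq, ← Finset.add_sum_erase (a := 0) _ _ (mem_support_iff.mpr h0)] at hz
    have hz' := eq_neg_of_add_eq_zero_left hz
    have hlt : ‖∑ α ∈ Q.support.erase 0, Q.coeff α * ∏ i ∈ α.support, (a i - b i) ^ α i‖ <
        ‖Q.coeff 0‖ := by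
      have hpos := norm_pos_iff.mpr h0
      obtain ⟨α, hα, hle⟩ := IsUltrametricDist.exists_norm_finsetSum_le (Q.support.erase 0)
        (fun α => Q.coeff α * ∏ i ∈ α.support, (a i - b i) ^ α i)
      rcases (Q.support.erase 0).eq_empty_or_nonempty with he | hne
      · simpa [he] using hpos
      refine hle.trans_lt ?_
      have hα := Finset.mem_erase.mp (hα hne)
      have hc := norm_pos_iff.mpr (mem_support_iff.mp hα.2)
      refine lt_of_lt_of_le ?_ (hcoeff α)
      rw [norm_mul, norm_prod]
      refine mul_lt_mul_of_pos_left ?_ hc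
      rw [Finsupp.degree_apply, ← Finset.prod_pow_eq_pow_sum]
      obtain ⟨i, hi⟩ := Finsupp.support_nonempty_iff.mpr hα.1
      by_cases hall : ∀ j ∈ α.support, a j - b j ≠ 0
      · refine Finset.prod_lt_prod_of_nonempty (fun j hj => ?_) (fun j hj => ?_) ⟨i, hi⟩
        · exact norm_pos_iff.mpr (pow_ne_zero _ (hall j hj))
        · rw [norm_pow]
          exact pow_lt_pow_left₀ (ha j) (norm_nonneg _) (Finsupp.mem_support_iff.mp hj)
      · push Not at hall
        obtain ⟨j, hj, hj0⟩ := hall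
        rw [Finset.prod_eq_zero hj (by
          rw [hj0, zero_pow (Finsupp.mem_support_iff.mp hj), norm_zero])]
        exact Finset.prod_pos fun _ _ => by positivity
    simp only [Finsupp.support_zero, Finset.prod_empty, mul_one] at hz'
    rw [hz', norm_neg] at hlt
    exact lt_irrefl _ hlt

end Independence

section Bridge

variable {k : Type u} {K : Type v} [Field k] [NormedField K] [IsUltrametricDist K]
  [CompleteSpace K] [Algebra k K]

instance : IsUltrametricDist (AlgebraicClosure K) :=
  IsUltrametricDist.isUltrametricDist_of_isNonarchimedean_norm
    (isNonarchimedean_spectralNorm (K := K) (L := AlgebraicClosure K))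

variable (k) in
/-- The topological closure of `k(S)ᵃ` in `Kᵃ`. -/
def taSpan (S : Set K) : Subfield (AlgebraicClosure K) :=
  (algSpan k (algebraMap K (AlgebraicClosure K) '' S)).topologicalClosure

theorem mem_algSpan_image_iff {S : Set K} {x : AlgebraicClosure K} :
    x ∈ algSpan k (algebraMap K (AlgebraicClosure K) '' S) ↔
      IsAlgebraic (IntermediateField.adjoin k S) x := by
  let A := algebraMap K (AlgebraicClosure K) '' S
  constructor
  · intro hx
    refine mem_algebraicClosure_iff.mp (algSpan_le_of_subset
      (E := (algebraicClosure (IntermediateField.adjoin k S) (AlgebraicClosure K)).toSubfield)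
      (fun c => ?_) (fun y hy => ?_) ?_ hx)
    · exact mem_algebraicClosure_iff.mpr (isAlgebraic_algebraMap
        (algebraMap k (IntermediateField.adjoin k S) c))
    · have : IsAlgebraic (algebraicClosure (IntermediateField.adjoin k S) (AlgebraicClosure K)) y :=
        hy
      exact mem_algebraicClosure_iff.mpr (this.restrictScalars _)
    · rintro _ ⟨s, hs, rfl⟩
      exact mem_algebraicClosure_iff.mpr (isAlgebraic_algebraMap
        (⟨s, IntermediateField.subset_adjoin k S hs⟩ : IntermediateField.adjoin k S))
  · intro hx
    have hle : IntermediateField.adjoin k S ≤ (IntermediateField.adjoin k A).comap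
        (IsScalarTower.toAlgHom k K (AlgebraicClosure K)) :=
      IntermediateField.adjoin_le_iff.mpr fun s hs =>
        IntermediateField.subset_adjoin k A ⟨s, hs, rfl⟩
    let ψ : IntermediateField.adjoin k S →+* IntermediateField.adjoin k A :=
      { toFun := fun c => ⟨algebraMap K (AlgebraicClosure K) c, hle c.2⟩
        map_one' := Subtype.ext (map_one _)
        map_zero' := Subtype.ext (map_zero _)
        map_mul' := fun c d => Subtype.ext (map_mul _ (c : K) d)
        map_add' := fun c d => Subtype.ext (map_add _ (c : K) d) }
    exact mem_algSpan.mpr (hx.ringHom_of_comp_eq ψ (RingHom.id (AlgebraicClosure K))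
      ψ.injective rfl)

theorem setOf_isAlgebraic_eq_image (S : Set K) :
    {x : CompletedAlgClosure K | IsAlgebraic (IntermediateField.adjoin k S) x} =
      (fun x : AlgebraicClosure K => (x : CompletedAlgClosure K)) ''
        (algSpan k (algebraMap K (AlgebraicClosure K) '' S)) := by
  have key (p : Polynomial (IntermediateField.adjoin k S)) :
      p.map (algebraMap (IntermediateField.adjoin k S) (CompletedAlgClosure K)) =
        (p.map (algebraMap (IntermediateField.adjoin k S) (AlgebraicClosure K))).map
          (UniformSpace.Completion.coeRingHom (α := AlgebraicClosure K)) := by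
    rw [Polynomial.map_map]
    rfl
  ext x
  constructor
  · rintro ⟨p, hp, hx⟩
    rw [Polynomial.aeval_def, Polynomial.eval₂_eq_eval_map, key] at hx
    have hp' : p.map (algebraMap (IntermediateField.adjoin k S) (AlgebraicClosure K)) ≠ 0 :=
      (Polynomial.map_ne_zero_iff (RingHom.injective _)).mpr hp
    have hmem := (Polynomial.mem_roots ((Polynomial.map_ne_zero_iff
      (UniformSpace.Completion.coeRingHom (α := AlgebraicClosure K)).injective).mpr hp')).mpr hx
    rw [(IsAlgClosed.splits _).roots_map, Multiset.mem_map] at hmem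
    obtain ⟨y, hy, rfl⟩ := hmem
    refine ⟨y, mem_algSpan_image_iff.mpr ⟨p, hp, ?_⟩, rfl⟩
    rw [Polynomial.aeval_def, Polynomial.eval₂_eq_eval_map]
    exact Polynomial.isRoot_of_mem_roots hy
  · rintro ⟨y, hy, rfl⟩
    obtain ⟨p, hp, hy⟩ := mem_algSpan_image_iff.mp hy
    refine ⟨p, hp, ?_⟩
    rw [Polynomial.aeval_def, Polynomial.eval₂_eq_eval_map] at hy ⊢
    rw [key]
    change Polynomial.eval (UniformSpace.Completion.coeRingHom (α := AlgebraicClosure K) y) _ = 0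
    rw [Polynomial.eval_map_apply, hy, map_zero]

theorem coe_mem_taClosure_iff {S : Set K} {x : AlgebraicClosure K} :
    (x : CompletedAlgClosure K) ∈ taClosure k S ↔ x ∈ taSpan k S := by
  have h := (UniformSpace.Completion.isDenseInducing_coe
    (α := AlgebraicClosure K)).isInducing.closure_eq_preimage_closure_image
    (algSpan k (algebraMap K (AlgebraicClosure K) '' S) : Set (AlgebraicClosure K))
  rw [taClosure, setOf_isAlgebraic_eq_image]
  change _ ↔ x ∈ closure _
  rw [h]
  rfl

theorem mem_taSpan_of_mem {S : Set K} {s : K} (hs : s ∈ S) :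
    algebraMap K (AlgebraicClosure K) s ∈ taSpan k S :=
  Subfield.le_topologicalClosure _ (subset_algSpan _ ⟨s, hs, rfl⟩)

theorem taClosure_subset_of_forall_mem_taSpan {S S' : Set K}
    (h : ∀ s ∈ S, algebraMap K (AlgebraicClosure K) s ∈ taSpan k S') :
    taClosure k S ⊆ taClosure k S' := by
  rw [taClosure, setOf_isAlgebraic_eq_image]
  refine closure_minimal ?_ isClosed_closure
  rintro _ ⟨x, hx, rfl⟩
  refine coe_mem_taClosure_iff.mpr (algSpan_le_topologicalClosure ?_ hx)
  rintro _ ⟨s, hs, rfl⟩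
  exact h s hs

theorem taSpan_mono {S S' : Set K} (h : S ⊆ S') : taSpan k S ≤ taSpan k S' :=
  topologicalClosure_algSpan_mono (Set.image_mono h)

theorem taClosure_mono {S S' : Set K} (h : S ⊆ S') : taClosure k S ⊆ taClosure k S' :=
  taClosure_subset_of_forall_mem_taSpan fun _ hs => mem_taSpan_of_mem (h hs)

theorem taIndependent_iff {S : Set K} : TAIndependent k S ↔
    ∀ s ∈ S, algebraMap K (AlgebraicClosure K) s ∉ taSpan k (S \ {s}) := by
  constructor
  · intro h s hs hmem
    refine (h (S \ {s}) ⟨Set.sdiff_subset, fun h' => (h' hs).2 rfl⟩).2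
      (taClosure_subset_of_forall_mem_taSpan fun t ht => ?_)
    by_cases hts : t = s
    · rwa [hts]
    · exact mem_taSpan_of_mem ⟨ht, hts⟩
  · intro h S' hS'
    obtain ⟨s, hs, hs'⟩ := Set.exists_of_ssubset hS'
    refine ⟨taClosure_mono hS'.1, fun hle => h s hs ?_⟩
    have h1 := coe_mem_taClosure_iff.mp (hle (coe_mem_taClosure_iff.mpr (mem_taSpan_of_mem hs)))
    have h2 : S' ⊆ S \ {s} := fun t ht => ⟨hS'.1 ht, fun hts => hs' (hts ▸ ht)⟩
    exact taSpan_mono h2 h1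

theorem taGenerating_of_forall_mem_taSpan {S S' : Set K} (hS : TAGenerating k S)
    (h : ∀ s ∈ S, algebraMap K (AlgebraicClosure K) s ∈ taSpan k S') : TAGenerating k S' :=
  Set.eq_univ_of_univ_subset (hS.symm.subset.trans (taClosure_subset_of_forall_mem_taSpan h))

theorem TAGenerating.mem_taSpan {S : Set K} (hS : TAGenerating k S) (x : AlgebraicClosure K) :
    x ∈ taSpan k S :=
  coe_mem_taClosure_iff.mp (hS.symm.subset (Set.mem_univ _))

/-- A generating set of minimal cardinality is independent if it is finite. -/
theorem TAGenerating.taIndependent_of_minimal {S : Set K} (hS : TAGenerating k S)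
    (hfin : S.Finite) (hmin : ∀ S' : Set K, TAGenerating k S' → #S ≤ #S') :
    TAIndependent k S := by
  intro S' hS'
  refine ⟨taClosure_mono hS'.1, fun hle => ?_⟩
  have h1 : TAGenerating k S' := Set.eq_univ_of_univ_subset (hS.symm.subset.trans hle)
  have h2 := hmin S' h1
  have h3 := Set.ncard_lt_ncard hS' hfin
  have := hfin.to_subtype
  have := (hfin.subset hS'.1).to_subtype
  rw [← Set.cast_ncard hfin, ← Set.cast_ncard (hfin.subset hS'.1)] at h2
  exact absurd (by exact_mod_cast h2) (not_le.mpr h3)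

end Bridge

section UpperBound

variable {k : Type u} {K : Type v} [Field k] [NormedField K] [IsUltrametricDist K]
  [CompleteSpace K] [Algebra k K]

theorem cardinalMk_le_of_separated {S T : Set K} (hS : TAGenerating k S) {ε : ℝ} (hε : 0 < ε)
    (hT : ∀ t ∈ T, ∀ f ∈ algSpan k (algebraMap K (AlgebraicClosure K) '' (T \ {t})),
      ε ≤ ‖algebraMap K (AlgebraicClosure K) t - f‖) : #T ≤ #S := by
  let b : T → AlgebraicClosure K := fun t => algebraMap K (AlgebraicClosure K) t
  have hb : IsSeparated k ε b := by
    intro t f hf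
    refine hT t t.2 f (algSpan_mono ?_ hf)
    rintro _ ⟨t', ht', rfl⟩
    exact ⟨t', ⟨t'.2, fun h => ht' (Subtype.ext h)⟩, rfl⟩
  choose a ha hab using fun t : T => exists_mem_algSpan_near (hS.mem_taSpan (b t)) hε
  have hind := hb.algebraicIndependent (a := a) fun t => by rw [norm_sub_rev]; exact hab t
  exact (cardinalMk_le_of_mem_algSpan hind ha).trans mk_image_le

theorem TAIndependent.cardinalMk_le {S T : Set K} (hT : TAIndependent k T)
    (hS : TAGenerating k S) (hcard : #S ≤ ℵ₀) : #T ≤ #S := by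
  have hsep : ∀ t ∈ T, ∃ ε > 0, ∀ f ∈ algSpan k (algebraMap K (AlgebraicClosure K) '' (T \ {t})),
      ε ≤ ‖algebraMap K (AlgebraicClosure K) t - f‖ := by
    intro t ht
    by_contra! h
    exact taIndependent_iff.mp hT t ht (mem_topologicalClosure_of_near h)
  choose! ε hε hsep using hsep
  have hsub {T₀ : Set K} (h₀ : T₀ ⊆ T) {δ : ℝ} (hδ : 0 < δ) (hle : ∀ t ∈ T₀, δ ≤ ε t) :
      #T₀ ≤ #S :=
    cardinalMk_le_of_separated hS hδ fun t ht f hf => (hle t ht).trans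
      (hsep t (h₀ ht) f (algSpan_mono (Set.image_mono (Set.sdiff_subset_sdiff_left h₀)) hf))
  rcases hcard.lt_or_eq with hlt | heq
  · by_contra! hgt
    obtain ⟨m, hm⟩ := Cardinal.lt_aleph0.mp hlt
    rw [hm, ← Order.succ_le_iff] at hgt
    obtain ⟨T₀, h₀, hT₀⟩ := Cardinal.le_mk_iff_exists_subset.mp hgt
    have hT₀' : #T₀ = (m + 1 : ℕ) := by rw [hT₀, Cardinal.succ_natCast, Nat.cast_add, Nat.cast_one]
    have hfin : T₀.Finite := Cardinal.lt_aleph0_iff_set_finite.mp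
      (hT₀' ▸ Cardinal.natCast_lt_aleph0)
    have hne : T₀.Nonempty := by
      rw [Set.nonempty_iff_ne_empty]
      rintro rfl
      rw [Cardinal.mk_eq_zero] at hT₀'
      exact absurd (by exact_mod_cast hT₀') (Nat.succ_ne_zero m).symm
    obtain ⟨t₀, ht₀, hmin⟩ := Set.exists_min_image T₀ ε hfin hne
    have := hsub h₀ (hε t₀ (h₀ ht₀)) hmin
    rw [hT₀', hm] at this
    exact absurd (by exact_mod_cast this) (Nat.not_succ_le_self m)
  · rw [heq, Cardinal.le_aleph0_iff_set_countable]
    have hcov : T ⊆ ⋃ n : ℕ, {t ∈ T | 1 / ((n : ℝ) + 1) ≤ ε t} := by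
      intro t ht
      obtain ⟨n, hn⟩ := exists_nat_one_div_lt (hε t ht)
      exact Set.mem_iUnion.mpr ⟨n, ht, hn.le⟩
    refine (Set.countable_iUnion fun n => ?_).mono hcov
    rw [← Cardinal.le_aleph0_iff_set_countable, ← heq]
    exact hsub (fun t ht => ht.1) (Nat.one_div_pos_of_nat (n := n)) fun t ht => ht.2

end UpperBound

section FiniteGeneration

open Topology

variable {k : Type u} {K : Type v} [Field k] [NormedField K] [IsUltrametricDist K]
  [CompleteSpace K] [Algebra k K]

/-- If independent sets have at most `n` elements, then every `(n + 1)`-tuple is dependent. -/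
theorem exists_mem_taSpan_image_compl {n : ℕ} (hn : ∀ T : Set K, TAIndependent k T → #T ≤ n)
    (y : Fin (n + 1) → K) :
    ∃ i, algebraMap K (AlgebraicClosure K) (y i) ∈ taSpan k (y '' {i}ᶜ) := by
  by_contra! h
  have hinj : Function.Injective y := by
    intro i j hij
    by_contra hne
    exact h i (mem_taSpan_of_mem ⟨j, fun h' => hne h'.symm, hij.symm⟩)
  have hind : TAIndependent k (Set.range y) := by
    rw [taIndependent_iff]
    rintro _ ⟨i, rfl⟩ hmem
    have hsub : Set.range y \ {y i} ⊆ y '' {i}ᶜ := by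
      rintro _ ⟨⟨j, rfl⟩, hj⟩
      exact ⟨j, fun h' => hj (by rw [show j = i from h']; rfl), rfl⟩
    exact h i (taSpan_mono hsub hmem)
  have h1 := hn _ hind
  have h2 := Cardinal.mk_range_eq_of_injective hinj
  rw [Cardinal.mk_fin, Cardinal.lift_natCast, Cardinal.lift_uzero] at h2
  rw [h2] at h1
  exact absurd (by exact_mod_cast h1) (Nat.not_succ_le_self n)

/-- The tuples `y` such that `k(c, y)ᵃ` contains an element at distance less than `ε` from `s`. -/
def approximating (k : Type u) {K : Type v} [Field k] [NormedField K] [IsUltrametricDist K]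
    [CompleteSpace K] [Algebra k K] (n : ℕ) (c s : K) (ε : ℝ) : Set (Fin n → K) :=
  {y | ∃ f ∈ algSpan k (algebraMap K (AlgebraicClosure K) '' insert c (Set.range y)),
    ‖algebraMap K (AlgebraicClosure K) s - f‖ < ε}

theorem isOpen_approximating (n : ℕ) (c s : K) {ε : ℝ} (hε : 0 < ε) :
    IsOpen (approximating k n c s ε) := by
  let z : (Fin n → K) → Option (Fin n) → AlgebraicClosure K :=
    fun y o => algebraMap K (AlgebraicClosure K) (o.elim c y)
  have hz : Continuous z := by
    refine continuous_pi fun o => (continuous_algebraMap K (AlgebraicClosure K)).comp ?_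
    cases o with
    | none => exact continuous_const
    | some i => exact continuous_apply i
  have hr (y : Fin n → K) : algebraMap K (AlgebraicClosure K) '' insert c (Set.range y) =
      Set.range (z y) := by
    ext x
    simp [z, Option.exists, eq_comm]
  rw [isOpen_iff_mem_nhds]
  rintro y ⟨f, hf, hd⟩
  rw [hr] at hf
  filter_upwards [hz.continuousAt.eventually (eventually_exists_mem_algSpan_near hf hε)]
    with y' ⟨f', hf', hd'⟩
  refine ⟨f', by rwa [hr], ?_⟩
  rw [← sub_add_sub_cancel _ f f']
  exact (IsUltrametricDist.norm_add_le_max _ _).trans_lt (max_lt hd hd')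

theorem dense_approximating {n : ℕ} (hn : ∀ T : Set K, TAIndependent k T → #T ≤ n) {c : K}
    (hc : c ≠ 0) (hc1 : ‖c‖ < 1) (s : K) {ε : ℝ} (hε : 0 < ε) :
    Dense (approximating k (n + 1) c s ε) := by
  rw [Metric.dense_iff]
  intro y η hη
  obtain ⟨i, hi⟩ := exists_mem_taSpan_image_compl hn y
  obtain ⟨m, hm⟩ := exists_pow_lt_of_lt_one (show 0 < η / (‖s‖ + 1) by positivity) hc1
  have hsmall : ‖c ^ m * s‖ < η := by
    rw [norm_mul, norm_pow]
    rw [lt_div_iff₀ (by positivity)] at hm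
    nlinarith [norm_nonneg s, norm_nonneg c, pow_nonneg (norm_nonneg c) m]
  let y' := Function.update y i (y i + c ^ m * s)
  have hi' : algebraMap K (AlgebraicClosure K) (y i) ∈ taSpan k (insert c (Set.range y')) := by
    refine taSpan_mono ?_ hi
    rintro _ ⟨j, hj, rfl⟩
    exact Or.inr ⟨j, Function.update_of_ne hj _ _⟩
  have hy' : algebraMap K (AlgebraicClosure K) (y i + c ^ m * s) ∈
      taSpan k (insert c (Set.range y')) :=
    mem_taSpan_of_mem (Or.inr ⟨i, Function.update_self _ _ _⟩)
  have hc' : algebraMap K (AlgebraicClosure K) c ∈ taSpan k (insert c (Set.range y')) :=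
    mem_taSpan_of_mem (Set.mem_insert _ _)
  have hs : algebraMap K (AlgebraicClosure K) s ∈ taSpan k (insert c (Set.range y')) := by
    have h := div_mem (sub_mem hy' hi') (pow_mem hc' m)
    rwa [← map_sub, ← map_pow, ← map_div₀, add_sub_cancel_left,
      mul_div_cancel_left₀ _ (pow_ne_zero m hc)] at h
  refine ⟨y', ?_, exists_mem_algSpan_near hs hε⟩
  rw [Metric.mem_ball, dist_pi_lt_iff hη]
  intro j
  by_cases hj : j = i
  · subst hj
    simpa [y', dist_eq_norm] using hsmall
  · simpa [y', hj] using hη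

/-- In a nontrivially valued field, countable generation and a bound on the cardinalities of
independent sets imply finite generation. -/
theorem exists_finite_taGenerating_of_norm_ne_one {n : ℕ}
    (hn : ∀ T : Set K, TAIndependent k T → #T ≤ n) {c : K} (hc : c ≠ 0) (hc1 : ‖c‖ < 1)
    {S : Set K} (hS : TAGenerating k S) (hcount : S.Countable) :
    ∃ S' : Set K, S'.Finite ∧ TAGenerating k S' := by
  have := hcount.to_subtype
  have hd : Dense (⋂ p : S × ℕ, approximating k (n + 1) c (p.1 : K) (1 / ((p.2 : ℝ) + 1))) :=
    dense_iInter_of_isOpen (fun p => isOpen_approximating _ _ _ Nat.one_div_pos_of_nat)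
      fun p => dense_approximating hn hc hc1 _ Nat.one_div_pos_of_nat
  obtain ⟨y, hy⟩ := hd.nonempty
  rw [Set.mem_iInter] at hy
  refine ⟨insert c (Set.range y), (Set.finite_range y).insert c,
    taGenerating_of_forall_mem_taSpan hS fun s hs => mem_topologicalClosure_of_near fun ε hε => ?_⟩
  obtain ⟨m, hm⟩ := exists_nat_one_div_lt hε
  obtain ⟨f, hf, hfd⟩ := hy (⟨s, hs⟩, m)
  exact ⟨f, hf, hfd.trans hm⟩

end FiniteGeneration

section Trivial

variable {k : Type u} {K : Type v} [Field k] [NormedField K] [IsUltrametricDist K]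
  [CompleteSpace K] [Algebra k K]

theorem norm_algClosure_eq_one (h : ∀ c : K, c ≠ 0 → ‖c‖ = 1) {x : AlgebraicClosure K}
    (hx : x ≠ 0) : ‖x‖ = 1 := by
  have hle (c : K) : ‖c‖ ≤ 1 := by
    by_cases hc : c = 0
    · simp [hc]
    · exact (h c hc).le
  have hone (z : AlgebraicClosure K) : ‖z‖ ≤ 1 := by
    refine ciSup_le fun n => ?_
    unfold spectralValueTerms
    split_ifs with hn
    · refine Real.rpow_le_one (norm_nonneg _) (hle _) ?_
      have : (n : ℝ) < (minpoly K z).natDegree := by exact_mod_cast hn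
      exact one_div_nonneg.mpr (by linarith)
    · exact zero_le_one
  refine le_antisymm (hone x) ?_
  have h1 := hone x⁻¹
  rw [norm_inv] at h1
  exact (inv_le_one₀ (norm_pos_iff.mpr hx)).mp h1

theorem mem_algSpan_of_mem_taSpan (h : ∀ c : K, c ≠ 0 → ‖c‖ = 1) {S : Set K}
    {x : AlgebraicClosure K} (hx : x ∈ taSpan k S) :
    x ∈ algSpan k (algebraMap K (AlgebraicClosure K) '' S) := by
  obtain ⟨f, hf, hd⟩ := exists_mem_algSpan_near hx one_pos
  by_cases hxf : x - f = 0
  · rwa [sub_eq_zero.mp hxf]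
  · exact absurd (norm_algClosure_eq_one h hxf) hd.ne

/-- In a trivially valued field, a transcendence basis is independent and generating. -/
theorem exists_taIndependent_taGenerating (h : ∀ c : K, c ≠ 0 → ‖c‖ = 1) :
    ∃ B : Set K, TAIndependent k B ∧ TAGenerating k B := by
  obtain ⟨B, hB⟩ := exists_isTranscendenceBasis k K
  refine ⟨B, taIndependent_iff.mpr fun s hs hmem => ?_, ?_⟩
  · have h1 := mem_algSpan_image_iff.mp (mem_algSpan_of_mem_taSpan h hmem)
    have h2 : IsAlgebraic (IntermediateField.adjoin k (B \ {s})) s :=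
      (isAlgebraic_algebraMap_iff (algebraMap K (AlgebraicClosure K)).injective).mp h1
    rw [IntermediateField.isAlgebraic_adjoin_iff] at h2
    have h3 := hB.1.transcendental_adjoin (s := {t : B | t ≠ ⟨s, hs⟩}) (i := ⟨s, hs⟩)
      (fun h => h rfl)
    refine h3 ?_
    have h4 : Subtype.val '' {t : B | t ≠ ⟨s, hs⟩} = B \ {s} := by
      ext t
      constructor
      · rintro ⟨t, ht, rfl⟩
        exact ⟨t.2, fun h' => ht (Subtype.ext h')⟩
      · exact fun ht => ⟨⟨t, ht.1⟩, fun h' => ht.2 (congrArg Subtype.val h'), rfl⟩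
    rwa [h4]
  · refine taGenerating_of_forall_mem_taSpan (taGenerating_univ k K) fun s _ => ?_
    refine Subfield.le_topologicalClosure _ (mem_algSpan_image_iff.mpr ?_)
    have h1 := hB.isAlgebraic_field
    rw [Subtype.range_coe] at h1
    exact (h1.isAlgebraic s).algebraMap

end Trivial

section Degrees

variable {k : Type u} {K : Type v} [Field k] [NormedField K] [IsUltrametricDist K]
  [CompleteSpace K] [Algebra k K]

theorem exists_finite_taGenerating {n : ℕ} (hn : ∀ T : Set K, TAIndependent k T → #T ≤ n)
    {S : Set K} (hS : TAGenerating k S) (hcount : S.Countable) :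
    ∃ S' : Set K, S'.Finite ∧ TAGenerating k S' := by
  by_cases h : ∀ c : K, c ≠ 0 → ‖c‖ = 1
  · obtain ⟨B, hB, hB'⟩ := exists_taIndependent_taGenerating (k := k) h
    exact ⟨B, Cardinal.lt_aleph0_iff_set_finite.mp
      ((hn B hB).trans_lt Cardinal.natCast_lt_aleph0), hB'⟩
  · push Not at h
    obtain ⟨c, hc, hc1⟩ := h
    rcases hc1.lt_or_gt with hlt | hgt
    · exact exists_finite_taGenerating_of_norm_ne_one hn hc hlt hS hcount
    · refine exists_finite_taGenerating_of_norm_ne_one hn (inv_ne_zero hc) ?_ hS hcount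
      rw [norm_inv]
      exact inv_lt_one_of_one_lt₀ hgt

variable (k K)

theorem exists_taGenerating_cardinalMk_eq :
    ∃ S : Set K, TAGenerating k S ∧ #S = topGeneratingDegree k K :=
  csInf_mem (s := {c | ∃ S : Set K, TAGenerating k S ∧ #S = c})
    ⟨_, Set.univ, taGenerating_univ k K, rfl⟩

variable {k K}

theorem topGeneratingDegree_le {S : Set K} (hS : TAGenerating k S) :
    topGeneratingDegree k K ≤ #S :=
  csInf_le' ⟨S, hS, rfl⟩

theorem TAIndependent.cardinalMk_le_topTranscendenceDegree {T : Set K} (hT : TAIndependent k T) :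
    #T ≤ topTranscendenceDegree k K :=
  le_csSup (bddAbove_taIndependent k K) ⟨T, hT, rfl⟩

theorem topTranscendenceDegree_eq (h : topGeneratingDegree k K ≤ ℵ₀) :
    topTranscendenceDegree k K = topGeneratingDegree k K := by
  obtain ⟨S, hS, hcard⟩ := exists_taGenerating_cardinalMk_eq k K
  refine le_antisymm (csSup_le' ?_) ?_
  · rintro _ ⟨T, hT, rfl⟩
    rw [← hcard]
    exact hT.cardinalMk_le hS (hcard.trans_le h)
  rcases h.lt_or_eq with hlt | heq
  · rw [← hcard] at hlt ⊢
    refine (hS.taIndependent_of_minimal (Cardinal.lt_aleph0_iff_set_finite.mp hlt)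
      fun S' hS' => ?_).cardinalMk_le_topTranscendenceDegree
    rw [hcard]
    exact topGeneratingDegree_le hS'
  · rw [heq]
    by_contra! hlt
    obtain ⟨n, hn⟩ := Cardinal.lt_aleph0.mp hlt
    obtain ⟨S', hfin, hS'⟩ := exists_finite_taGenerating
      (fun T hT => hn ▸ TAIndependent.cardinalMk_le_topTranscendenceDegree hT) hS
      (Cardinal.le_aleph0_iff_set_countable.mp (hcard.trans_le h))
    exact absurd ((heq.symm.trans_le (topGeneratingDegree_le hS')).trans_lt
      (Cardinal.lt_aleph0_iff_set_finite.mpr hfin)) (lt_irrefl _)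

end Degrees

end AnalyticField

end

theorem mainTheorem7 {k K : Type*}
    [NormedField k] [IsUltrametricDist k] [CompleteSpace k]
    [NormedField K] [IsUltrametricDist K] [CompleteSpace K] [NormedAlgebra k K] :
    (AnalyticField.topGeneratingDegree k K ≤ Cardinal.aleph0 →
      AnalyticField.topTranscendenceDegree k K = AnalyticField.topGeneratingDegree k K) ∧
    (AnalyticField.topTranscendenceDegree k K < Cardinal.aleph0 →
      AnalyticField.topGeneratingDegree k K ≠ Cardinal.aleph0) := by
  refine ⟨AnalyticField.topTranscendenceDegree_eq, fun hlt heq => ?_⟩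
  rw [AnalyticField.topTranscendenceDegree_eq heq.le, heq] at hlt
  exact lt_irrefl _ hlt
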